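/- Let $M\ge 1$. For $u\in\mathbb Z$ let $\psi_u:\mathbb Z\to\{0,1\}$ be the indicator function of the residue class of $u$ modulo $M$. A function $\chi:\mathbb Z\to\{0,1,-1\}$ with period $M$ and mean value zero is called good if it is a finite sum of functions $\psi_u-\psi_v$ such that for each pair $(u,v)$ occurring there is a natural number $C$ with $\gcd(C,M)=1$ and $uC\equiv v\pmod M$. Let $\chi$ be a good function with period $M$, and let $a,b\in\mathbb Z$, $b\neq 0$, be such that $$P_{a,b,\chi}(q):=\sum_{n\ge 0} n\chi(n)\,q^{\frac{n^2-a^2}{b}}$$ lies in $\mathbb Z[[q]]$. Then there are unique coefficients $H_{a,b,\chi}(n)$ $(n\ge 0)$ with the asymptotic expansion $$P_{a,b,\chi}(e^{-t})\sim\sum_{n\ge 0}H_{a,b,\chi}(n)\,(1-e^{-t})^n\qquad(t\to 0^+).$$ Let $p$ be a prime with $p\nmid b$ and $p\nmid M$, and let $\beta_p$ be the coefficient of $p^1$ in the base $p$ expansion of the $p$-adic integer $-a^2/b$. Write $\left(\frac{m}{p}\right)=0$ if $p\mid m$, $=1$ if $m$ is a nonzero square modulo $p$, and $=-1$ otherwise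 (for $p=2$ also). Let $B$ be a positive integer. 1. If $\left(\frac{a^2-jb}{p}\right)=-1$ for all $1\le j\le B$, then for all integers $A,n\ge 1$ we have $p^An>B$ and $$H_{a,b,\chi}(p^An-B)\equiv 0\pmod{p^A}.$$ 2. If $\beta_p\ne p-1$ and $\left(\frac{a^2-jb}{p}\right)\ne 1$ for all $1\le j\le B$, then for all integers $A,n\ge 1$ we have $p^An>B$ and $$H_{a,b,\chi}(p^An-B)\equiv 0\pmod{p^A}.$$ Here $x\equiv 0\pmod{p^A}$ means that $x=p^Au/v$ with integers $u,v$ and $p\nmid v$. -/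

import Mathlib

open Filter Topology Asymptotics

/-- `ψ_u`: the indicator function of the residue class of `u` modulo `M`. -/
def residueIndicator (M : ℕ) (u x : ℤ) : ℤ := if x ≡ u [ZMOD (M : ℤ)] then 1 else 0

/-- A good function with period `M`: a function `χ : ℤ → {0, 1, -1}` with period `M` and mean value
zero which is a finite sum of functions `ψ_u - ψ_v`, where for each pair `(u, v)` that occurs there
is a natural number `C` coprime to `M` with `u C ≡ v (mod M)`. -/
structure IsGoodFunction (M : ℕ) (χ : ℤ → ℤ) : Prop where
  values : ∀ x, χ x = 0 ∨ χ x = 1 ∨ χ x = -1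
  periodic : Function.Periodic χ (M : ℤ)
  mean_zero : ∑ n ∈ Finset.range M, χ (n : ℤ) = 0
  exists_decomp : ∃ L : List (ℤ × ℤ),
    (∀ w ∈ L, ∃ C : ℕ, Nat.Coprime C M ∧ w.1 * (C : ℤ) ≡ w.2 [ZMOD (M : ℤ)]) ∧
    ∀ x, χ x = (L.map fun w => residueIndicator M w.1 x - residueIndicator M w.2 x).sum

/-- The coefficient of `q ^ e`, for a rational exponent `e`, in the formal series
`P_{a,b,χ} = ∑_{n ≥ 0} n χ(n) q ^ ((n² - a²) / b)`. (For `b ≠ 0`, at most one `n` contributes.) -/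
noncomputable def partialThetaCoeff (a b : ℤ) (χ : ℤ → ℤ) (e : ℚ) : ℤ :=
  ∑ᶠ n ∈ {n : ℕ | ((n : ℚ) ^ 2 - (a : ℚ) ^ 2) / (b : ℚ) = e}, (n : ℤ) * χ (n : ℤ)

/-- `P_{a,b,χ} ∈ ℤ[[q]]`: only exponents `0, 1, 2, …` occur in the formal series `P_{a,b,χ}`, whose
coefficients are integers in any case. -/
def PartialThetaIsPowerSeries (a b : ℤ) (χ : ℤ → ℤ) : Prop :=
  ∀ e : ℚ, partialThetaCoeff a b χ e ≠ 0 → ∃ k : ℕ, e = (k : ℚ)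

/-- The partial theta function `P_{a,b,χ}(q)` at a real number `0 < q < 1`. -/
noncomputable def partialTheta (a b : ℤ) (χ : ℤ → ℤ) (q : ℝ) : ℝ :=
  ∑' n : ℕ, (n : ℝ) * (χ (n : ℤ) : ℝ) * q ^ (((n : ℝ) ^ 2 - (a : ℝ) ^ 2) / (b : ℝ))

/-- The asymptotic expansion `P_{a,b,χ}(e^{-t}) ∼ ∑_{n ≥ 0} H(n) (1 - e^{-t})^n` as `t → 0⁺`. -/
def IsFishburnExpansion (a b : ℤ) (χ : ℤ → ℤ) (H : ℕ → ℝ) : Prop :=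
  ∀ N : ℕ, (fun t : ℝ => partialTheta a b χ (Real.exp (-t)) -
      ∑ n ∈ Finset.range N, H n * (1 - Real.exp (-t)) ^ n) =O[𝓝[>] (0 : ℝ)] fun t => t ^ N

/-- An asymptotic expansion in powers of `1 - e^{-t}` has at most one sequence of coefficients. -/
theorem IsFishburnExpansion.unique {a b : ℤ} {χ : ℤ → ℤ} {H H' : ℕ → ℝ}
    (h : IsFishburnExpansion a b χ H) (h' : IsFishburnExpansion a b χ H') : H = H' := by
  have hs : Tendsto (fun t : ℝ => 1 - Real.exp (-t)) (𝓝[>] (0 : ℝ)) (𝓝 0) := by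
    have hc : Continuous fun t : ℝ => 1 - Real.exp (-t) := by fun_prop
    have := (hc.tendsto 0).mono_left (nhdsWithin_le_nhds (s := Set.Ioi (0 : ℝ)))
    simpa using this
  have hpos : ∀ᶠ t : ℝ in 𝓝[>] (0 : ℝ), 0 < 1 - Real.exp (-t) := by
    filter_upwards [self_mem_nhdsWithin] with t ht
    have ht' : -t < 0 := by simpa using ht
    have := Real.exp_lt_exp.mpr ht'
    rw [Real.exp_zero] at this
    linarith
  have hts : (fun t : ℝ => t) =O[𝓝[>] (0 : ℝ)] fun t => 1 - Real.exp (-t) := by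
    refine IsBigO.of_bound 2 ?_
    have h1 : Set.Ioo (0 : ℝ) 1 ∈ 𝓝[>] (0 : ℝ) := Ioo_mem_nhdsGT one_pos
    filter_upwards [h1, hpos] with t ht hp
    rw [Real.norm_of_nonneg ht.1.le, Real.norm_of_nonneg hp.le]
    have h2 : (t + 1) * Real.exp (-t) ≤ 1 := by
      have h3 := Real.add_one_le_exp t
      calc (t + 1) * Real.exp (-t) ≤ Real.exp t * Real.exp (-t) := by gcongr
        _ = 1 := by rw [← Real.exp_add]; simp
    have h4 := Real.exp_pos (-t)
    nlinarith [ht.1, ht.2]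
  funext n
  induction n using Nat.strong_induction_on with
  | _ n ih =>
    have hd := (h' (n + 1)).sub (h (n + 1))
    have he : ∀ t : ℝ, (partialTheta a b χ (Real.exp (-t)) -
        ∑ k ∈ Finset.range (n + 1), H' k * (1 - Real.exp (-t)) ^ k) -
        (partialTheta a b χ (Real.exp (-t)) -
        ∑ k ∈ Finset.range (n + 1), H k * (1 - Real.exp (-t)) ^ k) =
        (H n - H' n) * (1 - Real.exp (-t)) ^ n := by
      intro t
      have hsum : ∑ k ∈ Finset.range n, H' k * (1 - Real.exp (-t)) ^ k =
          ∑ k ∈ Finset.range n, H k * (1 - Real.exp (-t)) ^ k :=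
        Finset.sum_congr rfl fun k hk => by rw [ih k (Finset.mem_range.mp hk)]
      rw [Finset.sum_range_succ, Finset.sum_range_succ, hsum]
      ring
    simp only [he] at hd
    obtain ⟨c, hc⟩ := (hd.trans (hts.pow (n + 1))).bound
    have hle : ∀ᶠ t : ℝ in 𝓝[>] (0 : ℝ), |H n - H' n| ≤ c * (1 - Real.exp (-t)) := by
      filter_upwards [hc, hpos] with t ht hp
      rw [norm_mul, Real.norm_of_nonneg (pow_pos hp n).le,
        Real.norm_of_nonneg (pow_pos hp (n + 1)).le, pow_succ] at ht
      have : |H n - H' n| * (1 - Real.exp (-t)) ^ n ≤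
          (c * (1 - Real.exp (-t))) * (1 - Real.exp (-t)) ^ n := by
        rw [← Real.norm_eq_abs]
        calc _ ≤ _ := ht
          _ = _ := by ring
      exact le_of_mul_le_mul_right this (pow_pos hp n)
    have hlim : Tendsto (fun t : ℝ => c * (1 - Real.exp (-t))) (𝓝[>] (0 : ℝ)) (𝓝 0) := by
      simpa using hs.const_mul c
    have h0 : |H n - H' n| ≤ 0 := ge_of_tendsto hlim hle
    have h1 : H n - H' n = 0 := abs_eq_zero.mp (le_antisymm h0 (abs_nonneg _))
    linarith

open Classical in
/-- The coefficients `H_{a,b,χ}(n)` of the expansion of `P_{a,b,χ}(e^{-t})` in powers of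
`1 - e^{-t}` as `t → 0⁺` (zero if there is no such expansion). -/
noncomputable def fishburnCoeff (a b : ℤ) (χ : ℤ → ℤ) : ℕ → ℝ :=
  if h : ∃ H : ℕ → ℝ, IsFishburnExpansion a b χ H then h.choose else 0

/-- `β_p`: the coefficient of `p ^ 1` in the base `p` expansion of the `p`-adic integer `-a² / b`,
where `p ∤ b`. If `r ∈ {0, …, p² - 1}` is the residue of `-a² / b` modulo `p²`, then
`r = r₀ + β_p p` with `0 ≤ r₀ < p`. -/
def secondDigit (p : ℕ) (a b : ℤ) : ℕ :=
  (-((a : ZMod (p ^ 2)) ^ 2) * (b : ZMod (p ^ 2))⁻¹).val / p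

/-- `x ≡ 0 (mod p ^ A)` for a rational number `x`, as elements of the localization `ℤ_(p)`:
`x = p ^ A * u / v` with integers `u`, `v` and `p ∤ v`. For an integer `x` this says
`p ^ A ∣ x`. -/
def IsZeroModPrimePow (p A : ℕ) (x : ℝ) : Prop :=
  ∃ u v : ℤ, ¬ (p : ℤ) ∣ v ∧ x = (p : ℝ) ^ A * (u : ℝ) / (v : ℝ)

/-! The mean-zero hypothesis regularizes the divergent sums `∑ χ n * g n`. Repeated summation by
parts gives `∑ c k * Δᵏ g 0` plus a remainder containing `Δᴷ g`, where the `c k` depend only on `χ`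
and `M`. For `b > 0` and `g n = n * exp (-t (n² - a²) / b)`, a Gaussian sampled with step `√(t /
b)`, the remainder is `O(t ^ N)` once `K` is large. Expanding `e^{-t y} = (1 - (1 - e^{-t}))^y`
binomially then gives `H m = (-1)ᵐ ∑ c k * Δᵏ f 0` with `f n = n * binom (x, m)` and `x = (n² - a²)
/ b`. The sum is finite because `f` is a polynomial in `n`. If `b < 0`, integrality of the exponents
makes the series vanish.

The only denominators in `c k` are powers of `M`, so for `p ∤ M` it suffices to bound `f n`
`p`-adically for every `n`. The congruence comes from `binom (m+B, B) * binom (x+B, m+B) = binom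
(x+B, B) * binom (x, m)`. The hypotheses force `B < p`, so `p^A ∣ m + B` makes the left side
divisible by `p^A`. Moreover `binom (x+B, B)` divides `n` in `ℤ_p`: up to units it is the product of
the `n² - (a² - j b)`, and the residue symbol conditions allow `p` to divide one only if `p ∣ n`. It
then divides only one, and exactly once, because `p² ∤ a² - j b`. -/

/-! ### Summation by parts against periodic sequences of mean zero -/

/-- A rational sequence with period `M` whose sum over a period vanishes. -/
structure IsMeanZeroPeriodic (M : ℕ) (χ : ℕ → ℚ) : Prop where
  periodic : Function.Periodic χ M
  sum_eq_zero : ∑ i ∈ Finset.range M, χ i = 0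

/-- The mean over a period of the partial sums of `χ`; this is the regularized value of `∑ χ n`. -/
def partialSumMean (M : ℕ) (χ : ℕ → ℚ) : ℚ :=
  (∑ j ∈ Finset.range M, ∑ i ∈ Finset.range j, χ i) / M

/-- The sequence paired with the forward difference of `g` when `∑ χ n * g n` is summed by parts. -/
def abelStep (M : ℕ) (χ : ℕ → ℚ) (n : ℕ) : ℚ :=
  partialSumMean M χ - ∑ i ∈ Finset.range (n + 1), χ i

/-- Partial sums of a mean-zero periodic sequence are periodic, and subtracting them from their mean
restores mean zero. This closure is what lets the summation by parts be iterated. -/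
theorem IsMeanZeroPeriodic.abelStep {M : ℕ} (hM : 0 < M) {χ : ℕ → ℚ}
    (h : IsMeanZeroPeriodic M χ) : IsMeanZeroPeriodic M (abelStep M χ) where
  periodic n := by
    unfold _root_.abelStep
    rw [show n + M + 1 = M + (n + 1) by ring, Finset.sum_range_add, h.sum_eq_zero, zero_add]
    congr 1
    exact Finset.sum_congr rfl fun i _ => by rw [add_comm]; exact h.periodic i
  sum_eq_zero := by
    unfold _root_.abelStep partialSumMean
    have key : ∑ n ∈ Finset.range M, ∑ i ∈ Finset.range (n + 1), χ i =
        ∑ n ∈ Finset.range M, ∑ i ∈ Finset.range n, χ i := by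
      have h1 := Finset.sum_range_succ (fun n => ∑ i ∈ Finset.range n, χ i) M
      have h2 := Finset.sum_range_succ' (fun n => ∑ i ∈ Finset.range n, χ i) M
      rw [h.sum_eq_zero] at h1
      simp only [Finset.sum_range_zero] at h2
      linarith
    have hM' : (M : ℚ) ≠ 0 := by positivity
    rw [Finset.sum_sub_distrib, key, Finset.sum_const, Finset.card_range, nsmul_eq_mul]
    field_simp
    ring

theorem IsMeanZeroPeriodic.abs_le {M : ℕ} (hM : 0 < M) {χ : ℕ → ℚ}
    (h : IsMeanZeroPeriodic M χ) (n : ℕ) :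
    ‖(χ n : ℝ)‖ ≤ ∑ i ∈ Finset.range M, ‖(χ i : ℝ)‖ := by
  rw [← h.periodic.map_mod_nat n]
  exact Finset.single_le_sum (f := fun i => ‖(χ i : ℝ)‖) (fun i _ => norm_nonneg _)
    (Finset.mem_range.mpr (Nat.mod_lt n hM))

theorem IsMeanZeroPeriodic.summable_mul {M : ℕ} (hM : 0 < M) {χ : ℕ → ℚ}
    (h : IsMeanZeroPeriodic M χ) {g : ℕ → ℝ} (hg : Summable g) :
    Summable fun n => (χ n : ℝ) * g n := by
  refine Summable.of_norm_bounded (hg.norm.mul_left (∑ i ∈ Finset.range M, ‖(χ i : ℝ)‖))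
    fun n => ?_
  rw [norm_mul]
  exact mul_le_mul_of_nonneg_right (h.abs_le hM n) (norm_nonneg _)

theorem Summable.fwdDiff {g : ℕ → ℝ} (hg : Summable g) : Summable (fwdDiff 1 g) :=
  ((summable_nat_add_iff 1).mpr hg).sub hg

/-- Summation by parts against a periodic sequence with mean zero. -/
theorem IsMeanZeroPeriodic.tsum_mul {M : ℕ} (hM : 0 < M) {χ : ℕ → ℚ}
    (h : IsMeanZeroPeriodic M χ) {g : ℕ → ℝ} (hg : Summable g) :
    ∑' n, (χ n : ℝ) * g n = (partialSumMean M χ : ℝ) * g 0 +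
      ∑' n, (_root_.abelStep M χ n : ℝ) * fwdDiff 1 g n := by
  have hT := h.abelStep hM
  have hg' : Summable fun n => g (n + 1) := (summable_nat_add_iff 1).mpr hg
  have s1 := hT.summable_mul hM hg
  have s2 := hT.summable_mul hM hg'
  have s3 := (summable_nat_add_iff 1).mpr s1
  rw [(h.summable_mul hM hg).tsum_eq_zero_add]
  have e0 : (χ 0 : ℝ) = partialSumMean M χ - _root_.abelStep M χ 0 := by
    simp [_root_.abelStep]
  have e1 : ∀ n, (χ (n + 1) : ℝ) * g (n + 1) = (_root_.abelStep M χ n : ℝ) * g (n + 1) -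
      (_root_.abelStep M χ (n + 1) : ℝ) * g (n + 1) := by
    intro n
    unfold _root_.abelStep
    rw [Finset.sum_range_succ _ (n + 1)]
    push_cast
    ring
  have e2 : ∀ n, (_root_.abelStep M χ n : ℝ) * _root_.fwdDiff 1 g n =
      (_root_.abelStep M χ n : ℝ) * g (n + 1) - (_root_.abelStep M χ n : ℝ) * g n := by
    intro n
    rw [_root_.fwdDiff]
    ring
  simp_rw [e1, e2]
  rw [s2.tsum_sub s3, s2.tsum_sub s1, s1.tsum_eq_zero_add, e0]
  ring

/-- The coefficients of the regularized sum `∑ χ n * g n = ∑ₖ cₖ * Δᵏ g 0`. -/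
def regularizedCoeff (M : ℕ) (χ : ℕ → ℚ) (k : ℕ) : ℚ :=
  partialSumMean M ((abelStep M)^[k] χ)

theorem IsMeanZeroPeriodic.iterate {M : ℕ} (hM : 0 < M) {χ : ℕ → ℚ}
    (h : IsMeanZeroPeriodic M χ) (k : ℕ) :
    IsMeanZeroPeriodic M ((_root_.abelStep M)^[k] χ) := by
  induction k with
  | zero => exact h
  | succ k ih => rw [Function.iterate_succ_apply']; exact ih.abelStep hM

theorem IsMeanZeroPeriodic.tsum_mul_iterate {M : ℕ} (hM : 0 < M) {χ : ℕ → ℚ}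
    (h : IsMeanZeroPeriodic M χ) {g : ℕ → ℝ} (hg : Summable g) (K : ℕ) :
    ∑' n, (χ n : ℝ) * g n = ∑ k ∈ Finset.range K, (regularizedCoeff M χ k : ℝ) *
        (fwdDiff 1)^[k] g 0 +
      ∑' n, (((_root_.abelStep M)^[K] χ) n : ℝ) * (fwdDiff 1)^[K] g n := by
  have hs : ∀ k, Summable ((_root_.fwdDiff 1)^[k] g) := by
    intro k
    induction k with
    | zero => exact hg
    | succ k ih => rw [Function.iterate_succ_apply']; exact ih.fwdDiff
  induction K with
  | zero => simp
  | succ K ih =>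
    rw [ih, (h.iterate hM K).tsum_mul hM (hs K), Finset.sum_range_succ,
      Function.iterate_succ_apply', Function.iterate_succ_apply', ← add_assoc]
    rfl

/-! ### Decay of forward differences of a sampled Gaussian -/

open Polynomial in
/-- The polynomial factor of the `k`-th derivative of `y * exp (-y²)`. -/
noncomputable def gaussDerivPoly : ℕ → ℝ[X]
  | 0 => X
  | k + 1 => derivative (gaussDerivPoly k) - 2 * X * gaussDerivPoly k

/-- The `k`-th derivative of `y * exp (-y²)`. -/
noncomputable def gaussDeriv (k : ℕ) (y : ℝ) : ℝ := (gaussDerivPoly k).eval y * Real.exp (-y ^ 2)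

theorem hasDerivAt_gaussDeriv (k : ℕ) (y : ℝ) :
    HasDerivAt (gaussDeriv k) (gaussDeriv (k + 1) y) y := by
  have h2 : HasDerivAt (fun y : ℝ => Real.exp (-y ^ 2)) (Real.exp (-y ^ 2) * (-(2 * y))) y := by
    have : HasDerivAt (fun y : ℝ => -y ^ 2) (-(2 * y)) y := by
      simpa using (hasDerivAt_pow 2 y).fun_neg
    exact this.exp
  refine (((gaussDerivPoly k).hasDerivAt y).fun_mul h2).congr_deriv ?_
  simp only [gaussDeriv, gaussDerivPoly, Polynomial.eval_sub, Polynomial.eval_mul,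
    Polynomial.eval_X, Polynomial.eval_ofNat]
  ring

theorem exists_polynomial_mul_exp_le (P : Polynomial ℝ) :
    ∃ C : ℝ, ∀ y : ℝ, |P.eval y| * Real.exp (-y ^ 2) ≤ C := by
  induction P using Polynomial.induction_on' with
  | add P Q hP hQ =>
    obtain ⟨C, hC⟩ := hP
    obtain ⟨D, hD⟩ := hQ
    refine ⟨C + D, fun y => ?_⟩
    rw [Polynomial.eval_add]
    have := Real.exp_pos (-y ^ 2)
    calc _ ≤ (|P.eval y| + |Q.eval y|) * Real.exp (-y ^ 2) := by
          gcongr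
          exact abs_add_le _ _
      _ ≤ C + D := by
          rw [add_mul]
          exact add_le_add (hC y) (hD y)
  | monomial n c =>
    refine ⟨|c| * (1 + n.factorial), fun y => ?_⟩
    rw [Polynomial.eval_monomial, abs_mul, abs_pow, mul_assoc]
    -- An even power can be absorbed by `exp (y²)` through a single term of its Taylor series.
    have hpow : |y| ^ n ≤ 1 + (y ^ 2) ^ n := by
      rw [← sq_abs y, ← pow_mul, mul_comm, pow_mul]
      nlinarith [sq_nonneg (|y| ^ n - 1), sq_nonneg (|y| ^ n)]
    have h1 : (y ^ 2) ^ n ≤ n.factorial * Real.exp (y ^ 2) := by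
      have := Real.pow_div_factorial_le_exp (y ^ 2) (sq_nonneg y) n
      rwa [div_le_iff₀ (by positivity), mul_comm] at this
    have h2 : Real.exp (y ^ 2) * Real.exp (-y ^ 2) = 1 := by rw [← Real.exp_add]; simp
    have h3 : Real.exp (-y ^ 2) ≤ 1 := Real.exp_le_one_iff.mpr (by nlinarith [sq_nonneg y])
    have h4 := Real.exp_pos (-y ^ 2)
    gcongr
    calc _ ≤ (1 + n.factorial * Real.exp (y ^ 2)) * Real.exp (-y ^ 2) := by
          gcongr
          exact hpow.trans (by linarith)
      _ = Real.exp (-y ^ 2) + n.factorial * (Real.exp (y ^ 2) * Real.exp (-y ^ 2)) := by ring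
      _ ≤ _ := by rw [h2]; linarith

theorem exists_gaussDeriv_le (k : ℕ) :
    ∃ C : ℝ, 0 ≤ C ∧ ∀ y : ℝ, |gaussDeriv k y| ≤ C / (1 + y ^ 2) := by
  -- The extra factor `1 + y²` buys a summable majorant.
  obtain ⟨C, hC⟩ := exists_polynomial_mul_exp_le (gaussDerivPoly k * (1 + Polynomial.X ^ 2))
  have hpos : ∀ y : ℝ, 0 < 1 + y ^ 2 := fun y => by positivity
  refine ⟨C, le_trans (by positivity) (hC 0), fun y => ?_⟩
  rw [le_div_iff₀ (hpos y)]
  have := hC y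
  rw [Polynomial.eval_mul, abs_mul] at this
  simp only [Polynomial.eval_add, Polynomial.eval_one, Polynomial.eval_pow, Polynomial.eval_X,
    abs_of_pos (hpos y)] at this
  rw [gaussDeriv, abs_mul, abs_of_pos (Real.exp_pos _)]
  linarith

theorem hasDerivAt_fwdDiff_iterate {F : ℕ → ℝ → ℝ} (hF : ∀ i x, HasDerivAt (F i) (F (i + 1) x) x)
    (h : ℝ) (k i : ℕ) (x : ℝ) :
    HasDerivAt ((fwdDiff h)^[k] (F i)) ((fwdDiff h)^[k] (F (i + 1)) x) x := by
  induction k generalizing x with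
  | zero => exact hF i x
  | succ k ih =>
    rw [Function.iterate_succ_apply', Function.iterate_succ_apply']
    exact ((ih (x + h)).comp_add_const x h).sub (ih x)

/-- Mean value inequality for iterated forward differences. -/
theorem abs_fwdDiff_iterate_le {F : ℕ → ℝ → ℝ} (hF : ∀ i x, HasDerivAt (F i) (F (i + 1) x) x)
    {h : ℝ} (hh : 0 ≤ h) {C x₀ : ℝ} (k i : ℕ) (hC : ∀ y, x₀ ≤ y → |F (i + k) y| ≤ C) (x : ℝ)
    (hx : x₀ ≤ x) : |(fwdDiff h)^[k] (F i) x| ≤ C * h ^ k := by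
  induction k generalizing i x with
  | zero => simpa using hC x hx
  | succ k ih =>
    rw [Function.iterate_succ_apply', fwdDiff]
    -- Differentiation commutes with differences, so the derivative is the same iterated difference
    -- of `F (i + 1)`; hence the induction must generalize `i`.
    have := (convex_Ici x₀).norm_image_sub_le_of_norm_hasDerivWithin_le
      (f := (fwdDiff h)^[k] (F i)) (f' := (fwdDiff h)^[k] (F (i + 1))) (C := C * h ^ k)
      (fun y _ => (hasDerivAt_fwdDiff_iterate hF h k i y).hasDerivWithinAt)
      (fun y hy => ih (i + 1) (fun z hz => by
        have := hC z hz
        rwa [show i + (k + 1) = i + 1 + k by ring] at this) y hy)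
      (x := x) (y := x + h) (Set.mem_Ici.mpr hx) (Set.mem_Ici.mpr (by linarith))
    rw [Real.norm_eq_abs, Real.norm_eq_abs, add_sub_cancel_left, abs_of_nonneg hh] at this
    rw [pow_succ, ← mul_assoc]
    exact this

/-- Each difference with step `ε` gains a factor `ε`. The loss of `ε²` comes from replacing `1 + (ε
n)²` by `ε² (1 + n²)`, a bound summable in `n`. -/
theorem exists_abs_fwdDiff_gauss_le (K : ℕ) : ∃ C : ℝ, 0 ≤ C ∧ ∀ ε : ℝ, 0 < ε → ε ≤ 1 → ∀ n : ℕ,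
    |(fwdDiff 1)^[K] (fun m : ℕ => gaussDeriv 0 (ε * m)) n| ≤
      C * ε ^ K / (ε ^ 2 * (1 + (n : ℝ) ^ 2)) := by
  obtain ⟨C, hC0, hC⟩ := exists_gaussDeriv_le K
  refine ⟨C, hC0, fun ε hε hε1 n => ?_⟩
  have e : ∀ k : ℕ, (fwdDiff 1)^[k] (fun m : ℕ => gaussDeriv 0 (ε * m)) =
      fun m : ℕ => (fwdDiff ε)^[k] (gaussDeriv 0) (ε * m) := by
    intro k
    induction k with
    | zero => rfl
    | succ k ih =>
      rw [Function.iterate_succ_apply', Function.iterate_succ_apply', ih]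
      funext m
      simp [fwdDiff, mul_add]
  rw [e]
  have h1 : ∀ y : ℝ, ε * n ≤ y → |gaussDeriv (0 + K) y| ≤ C / (ε ^ 2 * (1 + (n : ℝ) ^ 2)) := by
    intro y hy
    rw [zero_add]
    refine (hC y).trans ?_
    have h0 : 0 ≤ ε * n := by positivity
    have h2 : (ε * n) ^ 2 ≤ y ^ 2 := by gcongr
    have h3 : ε ^ 2 ≤ 1 := pow_le_one₀ hε.le hε1
    gcongr
    nlinarith
  refine (abs_fwdDiff_iterate_le hasDerivAt_gaussDeriv hε.le K 0 h1 _ le_rfl).trans (le_of_eq ?_)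
  ring

theorem summable_inv_one_add_sq : Summable fun n : ℕ => (1 + (n : ℝ) ^ 2)⁻¹ := by
  have h : Summable fun n : ℕ => 2 * ((n : ℝ) ^ 2)⁻¹ :=
    (Real.summable_nat_pow_inv.mpr one_lt_two).mul_left 2
  rw [← summable_nat_add_iff 1] at h ⊢
  refine Summable.of_nonneg_of_le (fun n => by positivity) (fun n => ?_) h
  push_cast
  rw [inv_eq_one_div, ← div_eq_mul_inv, div_le_div_iff₀ (by positivity) (by positivity)]
  nlinarith [sq_nonneg ((n : ℝ) + 1)]

/-! ### Binomial expansion and binomial coefficients -/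

/-- The binomial expansion of `(1 - x) ^ y` in powers of `x = 1 - e^{-t}`. -/
theorem isBigO_exp_sub_binomial (y : ℝ) (N : ℕ) :
    (fun t : ℝ => Real.exp (-(t * y)) - ∑ m ∈ Finset.range N,
      (-1) ^ m * Ring.choose y m * (1 - Real.exp (-t)) ^ m) =O[𝓝[>] (0 : ℝ)] fun t => t ^ N := by
  have h := (Real.one_add_rpow_hasFPowerSeriesAt_zero (a := y)).isBigO_sub_partialSum_pow N
  have hd : HasDerivAt (fun t : ℝ => Real.exp (-t) - 1) (-1) 0 := by
    have := ((hasDerivAt_neg (0 : ℝ)).exp).sub_const 1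
    simpa using this
  have ht : Tendsto (fun t : ℝ => Real.exp (-t) - 1) (𝓝[>] 0) (𝓝 0) := by
    have := hd.continuousAt.tendsto.mono_left (nhdsWithin_le_nhds (s := Set.Ioi (0 : ℝ)))
    simpa using this
  have hO : (fun t : ℝ => Real.exp (-t) - 1) =O[𝓝[>] (0 : ℝ)] fun t => t := by
    have := hd.isBigO_sub.mono (nhdsWithin_le_nhds (s := Set.Ioi (0 : ℝ)))
    simpa using this
  refine ((h.comp_tendsto ht).congr_left fun t => ?_).trans (hO.norm_left.pow N)
  simp only [Function.comp_apply, zero_add, FormalMultilinearSeries.partialSum,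
    binomialSeries_apply, add_sub_cancel, List.ofFn_const, List.prod_replicate, smul_eq_mul]
  rw [← Real.exp_mul]
  congr 1
  · ring_nf
  · refine Finset.sum_congr rfl fun m _ => ?_
    rw [← neg_sub (Real.exp (-t)) 1, neg_pow (Real.exp (-t) - 1) m]
    have : ((-1 : ℝ) ^ m) * (-1) ^ m = 1 := by rw [← mul_pow]; simp
    linear_combination (-(Ring.choose y m * (Real.exp (-t) - 1) ^ m)) * this

theorem isBigO_fwdDiff_iterate {r : ℝ → ℕ → ℝ} {l : Filter ℝ} {u : ℝ → ℝ}
    (h : ∀ n, (fun t => r t n) =O[l] u) (k n : ℕ) :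
    (fun t => (fwdDiff 1)^[k] (r t) n) =O[l] u := by
  induction k generalizing n with
  | zero => exact h n
  | succ k ih =>
    simp only [Function.iterate_succ_apply', fwdDiff]
    exact (ih _).sub (ih _)

theorem descPochhammer_smeval_eq_prod_range {R : Type*} [CommRing R] (x : R) (n : ℕ) :
    (descPochhammer ℤ n).smeval x = ∏ i ∈ Finset.range n, (x - i) := by
  induction n with
  | zero => simp
  | succ n ih =>
    rw [descPochhammer_succ_right, Polynomial.smeval_mul, ih, Finset.prod_range_succ,
      Polynomial.smeval_sub, Polynomial.smeval_X, Polynomial.smeval_natCast]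
    simp

theorem factorial_mul_choose_add_self {R : Type*} [CommRing R] [BinomialRing R] (x : R) (B : ℕ) :
    (B.factorial : R) * Ring.choose (x + B) B = ∏ j ∈ Finset.Icc 1 B, (x + (j : R)) := by
  rw [← nsmul_eq_mul, ← Ring.descPochhammer_eq_factorial_smul_choose,
    descPochhammer_smeval_eq_prod_range]
  refine Finset.prod_bij' (fun i _ => B - i) (fun j _ => B - j) ?_ ?_ ?_ ?_ ?_
  · intro i hi
    have := Finset.mem_range.mp hi
    exact Finset.mem_Icc.mpr (by omega)
  · intro j hj
    have := Finset.mem_Icc.mp hj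
    exact Finset.mem_range.mpr (by omega)
  · intro i hi
    have := Finset.mem_range.mp hi
    omega
  · intro j hj
    have := Finset.mem_Icc.mp hj
    omega
  · intro i hi
    have := Finset.mem_range.mp hi
    rw [Nat.cast_sub this.le]
    ring

/-! ### `p`-adic estimates -/

section

variable {p : ℕ} [Fact p.Prime]

theorem padicNorm_inv_natCast_le_one {M : ℕ} (hpM : ¬ p ∣ M) : ‖((M : ℚ_[p]))⁻¹‖ ≤ 1 := by
  have : ‖(M : ℚ_[p])‖ = 1 := by
    rw [Padic.norm_natCast_eq_one_iff]
    exact (Nat.Prime.coprime_iff_not_dvd Fact.out).mpr hpM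
  simp [this]

theorem padicNorm_sum_le {ι : Type*} (s : Finset ι) (f : ι → ℚ_[p]) {C : ℝ} (hC : 0 ≤ C)
    (h : ∀ i ∈ s, ‖f i‖ ≤ C) : ‖∑ i ∈ s, f i‖ ≤ C :=
  IsUltrametricDist.norm_sum_le_of_forall_le_of_nonneg hC h

theorem padicNorm_sub_le (x y : ℚ_[p]) : ‖x - y‖ ≤ max ‖x‖ ‖y‖ := by
  simpa [sub_eq_add_neg] using Padic.nonarchimedean x (-y)

theorem padicNorm_partialSumMean_le {M : ℕ} (hpM : ¬ p ∣ M) {χ : ℕ → ℚ}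
    (h : ∀ n, ‖(χ n : ℚ_[p])‖ ≤ 1) : ‖(partialSumMean M χ : ℚ_[p])‖ ≤ 1 := by
  unfold partialSumMean
  push_cast
  rw [div_eq_mul_inv, norm_mul]
  refine mul_le_one₀ ?_ (norm_nonneg _) (padicNorm_inv_natCast_le_one hpM)
  exact padicNorm_sum_le _ _ zero_le_one fun j _ => padicNorm_sum_le _ _ zero_le_one fun i _ => h i

theorem padicNorm_abelStep_le {M : ℕ} (hpM : ¬ p ∣ M) {χ : ℕ → ℚ}
    (h : ∀ n, ‖(χ n : ℚ_[p])‖ ≤ 1) (n : ℕ) : ‖(abelStep M χ n : ℚ_[p])‖ ≤ 1 := by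
  unfold abelStep
  push_cast
  refine (padicNorm_sub_le _ _).trans
    (max_le (padicNorm_partialSumMean_le hpM h) ?_)
  exact padicNorm_sum_le _ _ zero_le_one fun i _ => h i

/-- Each step of the summation by parts introduces no division other than by `M`, a `p`-adic unit.
-/
theorem padicNorm_regularizedCoeff_le {M : ℕ} (hpM : ¬ p ∣ M) {χ : ℕ → ℚ}
    (h : ∀ n, ‖(χ n : ℚ_[p])‖ ≤ 1) (k : ℕ) : ‖(regularizedCoeff M χ k : ℚ_[p])‖ ≤ 1 := by
  refine padicNorm_partialSumMean_le hpM ?_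
  induction k with
  | zero => exact h
  | succ k ih => rw [Function.iterate_succ_apply']; exact padicNorm_abelStep_le hpM ih

theorem padicNorm_fwdDiff_iterate_le {f : ℕ → ℚ} {C : ℝ}
    (h : ∀ n, ‖(f n : ℚ_[p])‖ ≤ C) (k n : ℕ) : ‖(((fwdDiff 1)^[k] f n : ℚ) : ℚ_[p])‖ ≤ C := by
  induction k generalizing n with
  | zero => exact h n
  | succ k ih =>
    rw [Function.iterate_succ_apply', fwdDiff]
    push_cast
    exact (padicNorm_sub_le _ _).trans (max_le (ih _) (ih _))

theorem isZeroModPrimePow_of_padicNorm_le {A : ℕ} {q : ℚ}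
    (h : ‖(q : ℚ_[p])‖ ≤ (p : ℝ) ^ (-A : ℤ)) : IsZeroModPrimePow p A (q : ℝ) := by
  have hp : (p : ℚ) ≠ 0 := by exact_mod_cast (Fact.out : p.Prime).ne_zero
  have hpR : (0 : ℝ) < p := by exact_mod_cast (Fact.out : p.Prime).pos
  -- This quotient is `p`-integral, so its reduced denominator is prime to `p` and serves as `v`.
  set r : ℚ := q / (p : ℚ) ^ A with hr
  have hr1 : ‖(r : ℚ_[p])‖ ≤ 1 := by
    rw [hr]
    push_cast
    rw [norm_div, norm_pow, Padic.norm_p, inv_pow, div_inv_eq_mul]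
    rw [zpow_neg, zpow_natCast] at h
    calc _ ≤ ((p : ℝ) ^ A)⁻¹ * (p : ℝ) ^ A := by gcongr
      _ = 1 := inv_mul_cancel₀ (by positivity)
  have hd : ¬ p ∣ r.den := by
    intro hdvd
    have h1 : ‖((r.den : ℕ) : ℚ_[p])‖ < 1 := Padic.norm_natCast_lt_one_iff.mpr hdvd
    have h2 : ‖((r.num : ℤ) : ℚ_[p])‖ = 1 := by
      rw [Padic.norm_intCast_eq_one_iff]
      exact Int.isCoprime_iff_gcd_eq_one.mpr (Nat.Coprime.coprime_dvd_right hdvd r.reduced)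
    have h3 : (r : ℚ_[p]) * (r.den : ℚ_[p]) = (r.num : ℚ_[p]) := by
      exact_mod_cast congrArg (fun x : ℚ => (x : ℚ_[p])) (Rat.mul_den_eq_num r)
    rw [← h3, norm_mul] at h2
    have : ‖(r : ℚ_[p])‖ * ‖(r.den : ℚ_[p])‖ ≤ 1 * ‖(r.den : ℚ_[p])‖ := by gcongr
    linarith
  refine ⟨r.num, r.den, by exact_mod_cast hd, ?_⟩
  have h4 : q = (p : ℚ) ^ A * r.num / r.den := by
    rw [mul_div_assoc, Rat.num_div_den, hr]
    field_simp
  exact_mod_cast congrArg (fun x : ℚ => (x : ℝ)) h4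

/-- The numerators `n² - a² + j b` of the factors of `(x + 1) ⋯ (x + B)`, `x = (n² - a²) / b`,
have together at most one factor `p`, and only if `p ∣ n`. -/
theorem norm_natCast_le_norm_prod {a b : ℤ} (hb : ¬ (p : ℤ) ∣ b) {B : ℕ} (hB : B < p)
    (hleg : ∀ j : ℕ, 1 ≤ j → j ≤ B → legendreSym p (a ^ 2 - (j : ℤ) * b) ≠ 1)
    (hsq : ∀ j : ℕ, 1 ≤ j → j ≤ B → ¬ ((p : ℤ) ^ 2 ∣ a ^ 2 - (j : ℤ) * b)) (n : ℕ) :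
    ‖(n : ℤ_[p])‖ ≤
      ‖∏ j ∈ Finset.Icc 1 B, (((n : ℤ) ^ 2 - (a ^ 2 - (j : ℤ) * b) : ℤ) : ℤ_[p])‖ := by
  have hpp : Prime (p : ℤ) := Nat.prime_iff_prime_int.mp Fact.out
  have hunit : ∀ z : ℤ, ¬ (p : ℤ) ∣ z → ‖(z : ℤ_[p])‖ = 1 := fun z hz =>
    le_antisymm (PadicInt.norm_le_one _) (not_lt.mp fun h => hz (PadicInt.norm_int_lt_one_iff_dvd z |>.mp h))
  rw [norm_prod]
  by_cases hall : ∀ j ∈ Finset.Icc 1 B, ¬ (p : ℤ) ∣ (n : ℤ) ^ 2 - (a ^ 2 - (j : ℤ) * b)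
  · rw [Finset.prod_eq_one fun j hj => hunit _ (hall j hj)]
    exact PadicInt.norm_le_one _
  push Not at hall
  obtain ⟨j, hj, hdvd⟩ := hall
  have hj' := Finset.mem_Icc.mp hj
  have hpn : (p : ℤ) ∣ n := by
    by_contra hn
    refine hleg j hj'.1 hj'.2 ?_
    have e : ((a ^ 2 - (j : ℤ) * b : ℤ) : ZMod p) = ((n : ℤ) : ZMod p) ^ 2 := by
      have := (ZMod.intCast_zmod_eq_zero_iff_dvd _ p).mpr hdvd
      push_cast at this ⊢
      linear_combination -this
    have hn0 : ((n : ℤ) : ZMod p) ≠ 0 := fun h => hn ((ZMod.intCast_zmod_eq_zero_iff_dvd _ p).mp h)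
    rw [legendreSym.eq_one_iff p (by rw [e]; exact pow_ne_zero 2 hn0), e]
    exact ⟨_, sq _⟩
  -- Modulo `p²` the factor is now `-(a² - j b)`, which is nonzero.
  have hpn2 : (p : ℤ) ^ 2 ∣ (n : ℤ) ^ 2 := pow_dvd_pow_of_dvd hpn 2
  rw [Finset.prod_eq_single_of_mem j hj]
  · have h1 : ‖(n : ℤ_[p])‖ ≤ (p : ℝ) ^ (-(1 : ℕ) : ℤ) := by
      have := (PadicInt.norm_int_le_pow_iff_dvd (p := p) (k := n) (n := 1)).mpr (by simpa using hpn)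
      simpa using this
    refine h1.trans (not_lt.mp fun h2 => hsq j hj'.1 hj'.2 ?_)
    have h3 : ‖(((n : ℤ) ^ 2 - (a ^ 2 - (j : ℤ) * b) : ℤ) : ℤ_[p])‖ ≤
        (p : ℝ) ^ (-(2 : ℕ) : ℤ) := by
      rw [PadicInt.norm_le_pow_iff_norm_lt_pow_add_one]
      simpa using h2
    exact (dvd_sub_right hpn2).mp (PadicInt.norm_int_le_pow_iff_dvd.mp h3)
  -- Two factors divisible by `p` would give `p ∣ (i - j) b` with `|i - j| < p`.
  · intro i hi hij
    refine hunit _ fun hdvd' => hij ?_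
    have hi' := Finset.mem_Icc.mp hi
    have h1 : (p : ℤ) ∣ ((i : ℤ) - j) * b := by
      have := dvd_sub hdvd' hdvd
      ring_nf at this ⊢
      exact this
    have h2 := (hpp.dvd_or_dvd h1).resolve_right hb
    have h3 := Int.eq_zero_of_abs_lt_dvd h2 (by rw [abs_lt]; constructor <;> omega)
    omega

/-- In `binom (m+B, B) * binom (x+B, m+B) = binom (x+B, B) * binom (x, m)` the first factor supplies
`p^A`, the second is `p`-integral, and `n` is at most as large as the third. -/
theorem norm_mul_choose_le {a b : ℤ} (hb : ¬ (p : ℤ) ∣ b) {B : ℕ} (hB0 : 0 < B) (hB : B < p)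
    (hleg : ∀ j : ℕ, 1 ≤ j → j ≤ B → legendreSym p (a ^ 2 - (j : ℤ) * b) ≠ 1)
    (hsq : ∀ j : ℕ, 1 ≤ j → j ≤ B → ¬ ((p : ℤ) ^ 2 ∣ a ^ 2 - (j : ℤ) * b)) (n : ℕ)
    {x : ℤ_[p]} (hx : (b : ℤ_[p]) * x = (n : ℤ_[p]) ^ 2 - (a : ℤ_[p]) ^ 2) {A m : ℕ}
    (hm : p ^ A ∣ m + B) :
    ‖(n : ℤ_[p]) * Ring.choose x m‖ ≤ (p : ℝ) ^ (-A : ℤ) := by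
  have hbn : ‖(b : ℤ_[p])‖ = 1 :=
    le_antisymm (PadicInt.norm_le_one _)
      (not_lt.mp fun h => hb (PadicInt.norm_int_lt_one_iff_dvd b |>.mp h))
  have hn : ‖(n : ℤ_[p])‖ ≤ ‖Ring.choose (x + B) B‖ := by
    have h1 : ‖((B.factorial : ℕ) : ℤ_[p])‖ = 1 := by
      rw [PadicInt.norm_natCast_eq_one_iff]
      exact ((Nat.Prime.coprime_iff_not_dvd Fact.out).mpr
        fun h => hB.not_ge ((Nat.Prime.dvd_factorial Fact.out).mp h))
    have h2 : ((B.factorial : ℕ) : ℤ_[p]) * Ring.choose (x + B) B =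
        ∏ j ∈ Finset.Icc 1 B, (x + (j : ℤ_[p])) := factorial_mul_choose_add_self x B
    have h3 : ‖Ring.choose (x + B) B‖ = ‖∏ j ∈ Finset.Icc 1 B, (x + (j : ℤ_[p]))‖ := by
      rw [← h2, norm_mul, h1, one_mul]
    rw [h3]
    refine (norm_natCast_le_norm_prod hb hB hleg hsq n).trans (le_of_eq ?_)
    rw [norm_prod, norm_prod]
    refine Finset.prod_congr rfl fun j _ => ?_
    rw [show (((n : ℤ) ^ 2 - (a ^ 2 - (j : ℤ) * b) : ℤ) : ℤ_[p]) =
      (b : ℤ_[p]) * (x + j) by push_cast; linear_combination -hx, norm_mul, hbn, one_mul]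
  have hc : ‖(((m + B).choose B : ℕ) : ℤ_[p])‖ ≤ (p : ℝ) ^ (-A : ℤ) := by
    have hdvd : p ^ A ∣ (m + B).choose B := by
      obtain ⟨k, rfl⟩ : ∃ k, B = k + 1 := ⟨B - 1, by omega⟩
      -- Absorption `(m+B) * binom (m+B-1, B-1) = B * binom (m+B, B)`, where `B < p` is prime to
      -- `p`.
      have h1 := Nat.add_one_mul_choose_eq (m + k) k
      have hcop : Nat.Coprime (p ^ A) (k + 1) := Nat.Coprime.pow_left _
        ((Nat.Prime.coprime_iff_not_dvd Fact.out).mpr (Nat.not_dvd_of_pos_of_lt hB0 hB))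
      refine hcop.dvd_of_dvd_mul_right ?_
      rw [← add_assoc, ← h1]
      exact Dvd.dvd.mul_right hm _
    have := (PadicInt.norm_int_le_pow_iff_dvd (p := p) (k := ((m + B).choose B : ℕ)) (n := A)).mpr
      (by exact_mod_cast hdvd)
    simpa using this
  have key := congrArg norm (Ring.choose_add_smul_choose x m B)
  rw [nsmul_eq_mul, norm_mul, norm_mul] at key
  calc _ = ‖(n : ℤ_[p])‖ * ‖Ring.choose x m‖ := norm_mul _ _
    _ ≤ ‖Ring.choose (x + B) B‖ * ‖Ring.choose x m‖ := by gcongr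
    _ = ‖(((m + B).choose B : ℕ) : ℤ_[p])‖ * ‖Ring.choose (x + B) (m + B)‖ := key.symm
    _ ≤ ‖(((m + B).choose B : ℕ) : ℤ_[p])‖ * 1 := by gcongr; exact PadicInt.norm_le_one _
    _ ≤ _ := by rw [mul_one]; exact hc

theorem padicNorm_mul_choose_le {a b : ℤ} (hb : ¬ (p : ℤ) ∣ b) {B : ℕ} (hB0 : 0 < B) (hB : B < p)
    (hleg : ∀ j : ℕ, 1 ≤ j → j ≤ B → legendreSym p (a ^ 2 - (j : ℤ) * b) ≠ 1)
    (hsq : ∀ j : ℕ, 1 ≤ j → j ≤ B → ¬ ((p : ℤ) ^ 2 ∣ a ^ 2 - (j : ℤ) * b)) (n : ℕ)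
    {A m : ℕ} (hm : p ^ A ∣ m + B) :
    ‖(((n : ℚ) * Ring.choose (((n : ℚ) ^ 2 - (a : ℚ) ^ 2) / (b : ℚ)) m : ℚ) : ℚ_[p])‖ ≤
      (p : ℝ) ^ (-A : ℤ) := by
  have hbn : ‖(b : ℚ_[p])‖ = 1 := by
    refine le_antisymm (Padic.norm_int_le_one _)
      (not_lt.mp fun h => hb (Padic.norm_intCast_lt_one_iff |>.mp h))
  have hb0 : (b : ℚ_[p]) ≠ 0 := norm_ne_zero_iff.mp (by rw [hbn]; exact one_ne_zero)
  have hx1 : ‖((n : ℚ_[p]) ^ 2 - (a : ℚ_[p]) ^ 2) / (b : ℚ_[p])‖ ≤ 1 := by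
    rw [norm_div, hbn, div_one]
    have := Padic.norm_int_le_one (p := p) ((n : ℤ) ^ 2 - a ^ 2)
    rwa [Int.cast_sub, Int.cast_pow, Int.cast_pow, Int.cast_natCast] at this
  obtain ⟨x, hxc⟩ : ∃ x : ℤ_[p],
      (x : ℚ_[p]) = ((n : ℚ_[p]) ^ 2 - (a : ℚ_[p]) ^ 2) / (b : ℚ_[p]) := ⟨⟨_, hx1⟩, rfl⟩
  have hmul : (b : ℤ_[p]) * x = (n : ℤ_[p]) ^ 2 - (a : ℤ_[p]) ^ 2 := by
    refine PadicInt.ext ?_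
    rw [PadicInt.coe_mul, PadicInt.coe_sub, PadicInt.coe_pow, PadicInt.coe_pow, hxc,
      PadicInt.coe_intCast, PadicInt.coe_intCast, PadicInt.coe_natCast, mul_div_cancel₀ _ hb0]
  have h1 := norm_mul_choose_le hb hB0 hB hleg hsq n hmul hm
  rw [PadicInt.norm_def, PadicInt.coe_mul] at h1
  convert h1 using 2
  push_cast
  congr 1
  -- Generalized binomial coefficients commute with ring homomorphisms, so those over `ℚ` and `ℤ_p`
  -- are compared in `ℚ_p`.
  rw [← eq_ratCast (Rat.castHom ℚ_[p]), Ring.map_choose]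
  rw [show ((Ring.choose x m : ℤ_[p]) : ℚ_[p]) = PadicInt.Coe.ringHom (Ring.choose x m) from rfl,
    Ring.map_choose]
  congr 1
  rw [show PadicInt.Coe.ringHom x = (x : ℚ_[p]) from rfl, hxc, map_div₀, map_sub, map_pow, map_pow,
    map_natCast, map_intCast, map_intCast]

/-- A block of `p` consecutive `j` meets a `j` with `a² - j b ≡ 1 (mod p)`. -/
theorem lt_of_legendreSym_ne_one {a b : ℤ} (hb : ¬ (p : ℤ) ∣ b) {B : ℕ}
    (hleg : ∀ j : ℕ, 1 ≤ j → j ≤ B → legendreSym p (a ^ 2 - (j : ℤ) * b) ≠ 1) : B < p := by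
  by_contra! hB
  have hb0 : (b : ZMod p) ≠ 0 := fun h => hb ((ZMod.intCast_zmod_eq_zero_iff_dvd _ p).mp h)
  -- Solves `a² - (y + 1) b = 1`; the shift by one keeps `j = y.val + 1` in `1, …, p`.
  set y : ZMod p := ((a : ZMod p) ^ 2 - 1) / b - 1 with hy
  have hlt := ZMod.val_lt y
  refine hleg (y.val + 1) (by omega) (by omega) ?_
  have e : ((a ^ 2 - ((y.val + 1 : ℕ) : ℤ) * b : ℤ) : ZMod p) = 1 := by
    push_cast
    rw [ZMod.natCast_zmod_val, hy]
    field_simp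
    ring
  rw [legendreSym.eq_one_iff p (by rw [e]; exact one_ne_zero), e]
  exact ⟨1, by ring⟩

/-- Here `-a² / b ≡ -j ≡ (p - 1) p + (p - j)` modulo `p²`, with `0 < p - j < p`. -/
theorem secondDigit_eq_of_sq_dvd {a b : ℤ} (hb : ¬ (p : ℤ) ∣ b) {j : ℕ} (hj : 1 ≤ j) (hjp : j < p)
    (h : (p : ℤ) ^ 2 ∣ a ^ 2 - (j : ℤ) * b) : secondDigit p a b = p - 1 := by
  have hp : p.Prime := Fact.out
  have hu : (b : ZMod (p ^ 2)) * (b : ZMod (p ^ 2))⁻¹ = 1 := by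
    refine ZMod.mul_inv_of_unit _ ?_
    rw [ZMod.coe_int_isUnit_iff_isCoprime, Nat.cast_pow]
    exact ((Nat.prime_iff_prime_int.mp hp).coprime_iff_not_dvd.mpr hb).pow_left
  have e : (a : ZMod (p ^ 2)) ^ 2 = j * b := by
    have := (ZMod.intCast_zmod_eq_zero_iff_dvd (a ^ 2 - (j : ℤ) * b) (p ^ 2)).mpr (by exact_mod_cast h)
    push_cast at this
    linear_combination this
  have hle : j ≤ p ^ 2 := by nlinarith
  have e2 : -((a : ZMod (p ^ 2)) ^ 2) * (b : ZMod (p ^ 2))⁻¹ = ((p ^ 2 - j : ℕ) : ZMod (p ^ 2)) := by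
    rw [Nat.cast_sub hle, ZMod.natCast_self, e]
    linear_combination (-(j : ZMod (p ^ 2))) * hu
  unfold secondDigit
  rw [e2, ZMod.val_natCast, Nat.mod_eq_of_lt (by omega)]
  rw [Nat.div_eq_iff hp.pos]
  obtain ⟨k, rfl⟩ : ∃ k, p = k + 1 := ⟨p - 1, by omega⟩
  have : (k + 1) ^ 2 = k * (k + 1) + (k + 1) := by ring
  simp only [Nat.add_sub_cancel]
  constructor <;> omega

end

/-! ### Asymptotic expansion for `b > 0` -/

/-- The rational sequence `n ↦ n * binom ((n² - a²) / b, m)`. -/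
noncomputable def binomialTerm (a b : ℤ) (m n : ℕ) : ℚ :=
  (n : ℚ) * Ring.choose (((n : ℚ) ^ 2 - (a : ℚ) ^ 2) / (b : ℚ)) m

/-- The coefficients of the expansion, as regularized sums
`(-1)ᵐ ∑ χ n * n * binom ((n² - a²) / b, m)`. -/
noncomputable def rationalFishburnCoeff (M : ℕ) (a b : ℤ) (χ : ℕ → ℚ) (m : ℕ) : ℚ :=
  (-1) ^ m * ∑ k ∈ Finset.range (2 * m + 2), regularizedCoeff M χ k *
    (fwdDiff 1)^[k] (binomialTerm a b m) 0

/-- The sequence is a polynomial in `n` of degree at most `2 m + 1`, so the cutoff `2 m + 2` in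
`rationalFishburnCoeff` loses nothing. -/
theorem fwdDiff_iterate_binomialTerm_eq_zero (a b : ℤ) {m k : ℕ} (hk : 2 * m + 1 < k) (n : ℕ) :
    (fwdDiff 1)^[k] (binomialTerm a b m) n = 0 := by
  set P : Polynomial ℚ := Polynomial.X * (Polynomial.C (m.factorial : ℚ)⁻¹ *
    ∏ i ∈ Finset.range m, (Polynomial.C (b : ℚ)⁻¹ * (Polynomial.X ^ 2 - Polynomial.C ((a : ℚ) ^ 2))
      - Polynomial.C (i : ℚ))) with hP
  have hdeg : P.natDegree < k := by
    have h2 : ∀ i : ℕ, (Polynomial.C (b : ℚ)⁻¹ * (Polynomial.X ^ 2 - Polynomial.C ((a : ℚ) ^ 2))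
        - Polynomial.C (i : ℚ)).natDegree ≤ 2 := by
      intro i
      compute_degree
    have h3 : (∏ i ∈ Finset.range m, (Polynomial.C (b : ℚ)⁻¹ *
        (Polynomial.X ^ 2 - Polynomial.C ((a : ℚ) ^ 2)) - Polynomial.C (i : ℚ))).natDegree ≤
        m * 2 := by
      refine (Polynomial.natDegree_prod_le _ _).trans ((Finset.sum_le_card_nsmul _ _ 2
        fun i _ => h2 i).trans ?_)
      simp
    have h4 : P.natDegree ≤ 1 + (0 + m * 2) :=
      Polynomial.natDegree_mul_le_of_le Polynomial.natDegree_X_le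
        (Polynomial.natDegree_mul_le_of_le (Polynomial.natDegree_C _).le h3)
    omega
  have heval : ∀ n : ℕ, binomialTerm a b m n = P.eval (n : ℚ) := by
    intro n
    rw [binomialTerm, Ring.choose_eq_smul, descPochhammer_smeval_eq_prod_range, hP]
    simp only [Polynomial.eval_mul, Polynomial.eval_X, Polynomial.eval_C, Polynomial.eval_prod,
      Polynomial.eval_sub, Polynomial.eval_pow, smul_eq_mul]
    congr 2
    refine Finset.prod_congr rfl fun i _ => ?_
    ring
  have h := congrFun (Polynomial.fwdDiff_iter_eq_zero_of_degree_lt hdeg) (n : ℚ)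
  rw [fwdDiff_iter_eq_sum_shift] at h ⊢
  rw [← h.trans (Pi.zero_apply _)]
  refine Finset.sum_congr rfl fun i _ => ?_
  rw [heval]
  simp

theorem fwdDiff_iterate_ratCast (f : ℕ → ℚ) (k n : ℕ) :
    (fwdDiff 1)^[k] (fun n => (f n : ℝ)) n = (((fwdDiff 1)^[k] f n : ℚ) : ℝ) := by
  induction k generalizing n with
  | zero => rfl
  | succ k ih =>
    rw [Function.iterate_succ_apply', Function.iterate_succ_apply', fwdDiff, fwdDiff, ih, ih]
    push_cast
    rfl

/-- The `n`-th weight `n * e^{-t (n² - a²) / b}` of the series at `q = e^{-t}`. -/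
noncomputable def thetaTerm (a b : ℤ) (t : ℝ) (n : ℕ) : ℝ :=
  (n : ℝ) * Real.exp (-(t * (((n : ℝ) ^ 2 - (a : ℝ) ^ 2) / (b : ℝ))))

theorem thetaTerm_eq_gaussDeriv (a b : ℤ) (hb : 0 < b) {t : ℝ} (ht : 0 < t) :
    thetaTerm a b t = (Real.exp (t * (a : ℝ) ^ 2 / b) * (√(t / b))⁻¹) •
      fun n : ℕ => gaussDeriv 0 (√(t / b) * n) := by
  have hbR : (0 : ℝ) < b := by exact_mod_cast hb
  have hs : 0 < √(t / b) := Real.sqrt_pos.mpr (by positivity)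
  funext n
  simp only [thetaTerm, gaussDeriv, gaussDerivPoly, Polynomial.eval_X, Pi.smul_apply, smul_eq_mul]
  have h1 : -(t * (((n : ℝ) ^ 2 - (a : ℝ) ^ 2) / (b : ℝ))) =
      t * (a : ℝ) ^ 2 / b + -(√(t / b) * n) ^ 2 := by
    rw [mul_pow, Real.sq_sqrt (by positivity)]
    ring
  rw [h1, Real.exp_add]
  field_simp

/-- Decay of the forward differences of the weights. -/
theorem exists_abs_fwdDiff_thetaTerm_le (a b : ℤ) (hb : 0 < b) (K : ℕ) :
    ∃ C : ℝ, 0 ≤ C ∧ ∀ t : ℝ, 0 < t → t ≤ b → ∀ n : ℕ,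
      |(fwdDiff 1)^[K] (thetaTerm a b t) n| ≤
        C * √(t / b) ^ K / √(t / b) ^ 3 * (1 + (n : ℝ) ^ 2)⁻¹ := by
  obtain ⟨C, hC0, hC⟩ := exists_abs_fwdDiff_gauss_le K
  have hbR : (0 : ℝ) < b := by exact_mod_cast hb
  refine ⟨Real.exp ((a : ℝ) ^ 2) * C, by positivity, fun t ht htb n => ?_⟩
  have hs : 0 < √(t / b) := Real.sqrt_pos.mpr (by positivity)
  have hs1 : √(t / b) ≤ 1 := Real.sqrt_le_one.mpr ((div_le_one hbR).mpr htb)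
  rw [thetaTerm_eq_gaussDeriv a b hb ht, fwdDiff_iter_const_smul, Pi.smul_apply, smul_eq_mul,
    abs_mul, abs_of_pos (by positivity)]
  have hexp : Real.exp (t * (a : ℝ) ^ 2 / b) ≤ Real.exp ((a : ℝ) ^ 2) := by
    rw [Real.exp_le_exp, div_le_iff₀ hbR, mul_comm]
    gcongr
  calc _ ≤ Real.exp ((a : ℝ) ^ 2) * (√(t / b))⁻¹ *
        (C * √(t / b) ^ K / (√(t / b) ^ 2 * (1 + (n : ℝ) ^ 2))) := by
        gcongr
        exact hC _ hs hs1 n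
    _ = _ := by field_simp

theorem summable_thetaTerm (a b : ℤ) (hb : 0 < b) {t : ℝ} (ht : 0 < t) (htb : t ≤ b) :
    Summable (thetaTerm a b t) := by
  obtain ⟨C, -, hC⟩ := exists_abs_fwdDiff_thetaTerm_le a b hb 0
  exact Summable.of_norm_bounded (summable_inv_one_add_sq.mul_left _) fun n => hC t ht htb n

theorem partialTheta_exp_eq_tsum (a b : ℤ) (χ : ℤ → ℤ) (t : ℝ) :
    partialTheta a b χ (Real.exp (-t)) =
      ∑' n : ℕ, (((χ n : ℤ) : ℚ) : ℝ) * thetaTerm a b t n := by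
  refine tsum_congr fun n => ?_
  rw [← Real.exp_mul, thetaTerm, neg_mul]
  push_cast
  ring

theorem isBigO_thetaTerm_sub (a b : ℤ) (N n : ℕ) :
    (fun t : ℝ => (thetaTerm a b t - ∑ m ∈ Finset.range N,
      ((-1) ^ m * (1 - Real.exp (-t)) ^ m) • fun n => (binomialTerm a b m n : ℝ)) n)
      =O[𝓝[>] (0 : ℝ)] fun t => t ^ N := by
  refine ((isBigO_exp_sub_binomial (((n : ℝ) ^ 2 - (a : ℝ) ^ 2) / (b : ℝ)) N).const_mul_left
    (n : ℝ)).congr_left fun t => ?_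
  simp only [thetaTerm, Pi.sub_apply, Finset.sum_apply, Pi.smul_apply, smul_eq_mul, mul_sub,
    Finset.mul_sum, binomialTerm]
  congr 1
  refine Finset.sum_congr rfl fun m _ => ?_
  have : (Ring.choose (((n : ℝ) ^ 2 - (a : ℝ) ^ 2) / (b : ℝ)) m) =
      ((Ring.choose (((n : ℚ) ^ 2 - (a : ℚ) ^ 2) / (b : ℚ)) m : ℚ) : ℝ) := by
    rw [← eq_ratCast (Rat.castHom ℝ), Ring.map_choose]
    simp
  rw [this]
  push_cast
  ring

theorem isFishburnExpansion_rationalFishburnCoeff {M : ℕ} (hM : 0 < M) {a b : ℤ} (hb : 0 < b)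
    {χ : ℤ → ℤ} (hχ : IsMeanZeroPeriodic M fun n => (χ n : ℚ)) :
    IsFishburnExpansion a b χ
      fun m => (rationalFishburnCoeff M a b (fun n => (χ n : ℚ)) m : ℝ) := by
  intro N
  -- The weights lose `√(t / b) ^ 3`, so `2 N` further differences leave `t ^ N`. Also `K ≥ 2 m + 2`
  -- for every `m < N`, as needed to extend the sums defining the coefficients.
  set K := 2 * N + 3 with hK
  set c := regularizedCoeff M (fun n => (χ n : ℚ)) with hc
  have hbR : (0 : ℝ) < b := by exact_mod_cast hb
  have hmem : ∀ᶠ t in 𝓝[>] (0 : ℝ), t ∈ Set.Ioo (0 : ℝ) b := Ioo_mem_nhdsGT hbR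
  obtain ⟨C, hC0, hC⟩ := exists_abs_fwdDiff_thetaTerm_le a b hb K
  have hrem : (fun t : ℝ => ∑' n, (((abelStep M)^[K] fun n => (χ n : ℚ)) n : ℝ) *
      (fwdDiff 1)^[K] (thetaTerm a b t) n) =O[𝓝[>] (0 : ℝ)] fun t => t ^ N := by
    have hb1 := (hχ.iterate hM K).abs_le hM
    set D := ∑ i ∈ Finset.range M, ‖((((abelStep M)^[K] fun n => (χ n : ℚ)) i : ℚ) : ℝ)‖
    have hD : 0 ≤ D := Finset.sum_nonneg fun _ _ => norm_nonneg _
    refine IsBigO.of_bound (D * C * (∑' n : ℕ, (1 + (n : ℝ) ^ 2)⁻¹) / (b : ℝ) ^ N) ?_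
    filter_upwards [hmem] with t ht
    have hs : 0 < √(t / b) := Real.sqrt_pos.mpr (div_pos ht.1 hbR)
    refine (tsum_of_norm_bounded ((summable_inv_one_add_sq.hasSum).mul_left
      (D * (C * √(t / b) ^ K / √(t / b) ^ 3))) fun n => ?_).trans (le_of_eq ?_)
    · rw [norm_mul, mul_assoc]
      exact mul_le_mul (hb1 n) (hC t ht.1 ht.2.le n) (norm_nonneg _) hD
    · have : √(t / b) ^ K = (t / b) ^ N * √(t / b) ^ 3 := by
        rw [hK, pow_add, pow_mul, Real.sq_sqrt (div_pos ht.1 hbR).le]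
      rw [this, mul_div_assoc, mul_div_cancel_right₀ _ (by positivity), norm_pow,
        Real.norm_of_nonneg ht.1.le, div_pow]
      ring
  -- Differences at `0` of order below `K` involve finitely many `n`, so the binomial expansion need
  -- not be uniform in `n`.
  have hmain : (fun t : ℝ => ∑ k ∈ Finset.range K, (c k : ℝ) *
      (fwdDiff 1)^[k] (thetaTerm a b t - ∑ m ∈ Finset.range N,
        ((-1) ^ m * (1 - Real.exp (-t)) ^ m) • fun n => (binomialTerm a b m n : ℝ)) 0)
      =O[𝓝[>] (0 : ℝ)] fun t => t ^ N :=
    IsBigO.fun_sum fun k _ => (isBigO_fwdDiff_iterate (isBigO_thetaTerm_sub a b N) k 0).const_mul_left _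
  refine (hmain.add hrem).congr' ?_ EventuallyEq.rfl
  filter_upwards [hmem] with t ht
  rw [partialTheta_exp_eq_tsum, hχ.tsum_mul_iterate hM (summable_thetaTerm a b hb ht.1 ht.2.le) K]
  have hsub : ∀ (f g : ℕ → ℝ) (k : ℕ), (fwdDiff 1)^[k] (f - g) 0 =
      (fwdDiff 1)^[k] f 0 - (fwdDiff 1)^[k] g 0 := by
    intro f g k
    have := fwdDiff_iter_add 1 (f - g) g k
    rw [sub_add_cancel] at this
    rw [this]
    simp
  have hH : ∑ m ∈ Finset.range N, (rationalFishburnCoeff M a b (fun n => (χ n : ℚ)) m : ℝ) *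
      (1 - Real.exp (-t)) ^ m = ∑ k ∈ Finset.range K, (c k : ℝ) *
      (fwdDiff 1)^[k] (∑ m ∈ Finset.range N,
        ((-1) ^ m * (1 - Real.exp (-t)) ^ m) • fun n => (binomialTerm a b m n : ℝ)) 0 := by
    simp_rw [fwdDiff_iter_finsetSum, Finset.sum_apply, fwdDiff_iter_const_smul, Pi.smul_apply,
      fwdDiff_iterate_ratCast, Finset.mul_sum, smul_eq_mul]
    rw [Finset.sum_comm]
    refine Finset.sum_congr rfl fun m hm => ?_
    have hm' := Finset.mem_range.mp hm
    have hext : ∑ k ∈ Finset.range (2 * m + 2), c k * (fwdDiff 1)^[k] (binomialTerm a b m) 0 =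
        ∑ k ∈ Finset.range K, c k * (fwdDiff 1)^[k] (binomialTerm a b m) 0 := by
      refine Finset.sum_subset (Finset.range_mono (by omega)) fun k _ hk => ?_
      rw [fwdDiff_iterate_binomialTerm_eq_zero a b (by rw [Finset.mem_range] at hk; omega), mul_zero]
    rw [rationalFishburnCoeff, ← hc, hext]
    push_cast
    rw [Finset.mul_sum, Finset.sum_mul]
    refine Finset.sum_congr rfl fun k _ => ?_
    ring
  rw [hH]
  simp_rw [hsub, mul_sub, Finset.sum_sub_distrib]
  ring

/-! ### The case `b < 0` and the conclusion -/

theorem partialThetaCoeff_self (a b : ℤ) (hb : b ≠ 0) (χ : ℤ → ℤ) (n : ℕ) :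
    partialThetaCoeff a b χ (((n : ℚ) ^ 2 - (a : ℚ) ^ 2) / (b : ℚ)) = n * χ n := by
  have hbQ : (b : ℚ) ≠ 0 := by exact_mod_cast hb
  have hset : {k : ℕ | ((k : ℚ) ^ 2 - (a : ℚ) ^ 2) / (b : ℚ) =
      ((n : ℚ) ^ 2 - (a : ℚ) ^ 2) / (b : ℚ)} = {n} := by
    ext k
    simp only [Set.mem_ofPred_eq, Set.mem_singleton_iff]
    rw [div_left_inj' hbQ, sub_left_inj]
    norm_cast
    exact Nat.pow_left_inj two_ne_zero
  rw [partialThetaCoeff, hset, finsum_mem_singleton]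

/-- For `b < 0` only finitely many exponents are nonnegative, which forces `χ` to vanish. -/
theorem eq_zero_of_partialThetaIsPowerSeries {M : ℕ} (hM : 0 < M) {a b : ℤ} (hb : b < 0)
    {χ : ℤ → ℤ} (hper : Function.Periodic χ (M : ℤ)) (hP : PartialThetaIsPowerSeries a b χ)
    (x : ℕ) : χ x = 0 := by
  by_contra hx
  -- Congruent to `x` modulo `M` and larger than `|a|`, so its exponent is negative.
  set n : ℕ := x + (a.natAbs + 1) * M with hn
  have hχn : χ n = χ x := by
    rw [hn]
    push_cast
    have := hper.nat_mul (a.natAbs + 1) (x : ℤ)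
    push_cast at this
    exact this
  have hlt : a.natAbs < n := by nlinarith
  have hn0 : (n : ℤ) ≠ 0 := by omega
  obtain ⟨k, hk⟩ := hP (((n : ℚ) ^ 2 - (a : ℚ) ^ 2) / (b : ℚ)) (by
    rw [partialThetaCoeff_self a b hb.ne, hχn]
    exact mul_ne_zero hn0 hx)
  have hbQ : (b : ℚ) < 0 := by exact_mod_cast hb
  have h1 : (a : ℚ) ^ 2 < (n : ℚ) ^ 2 := by
    have : a ^ 2 < (n : ℤ) ^ 2 := by
      rw [← Int.natAbs_sq a]
      have : (a.natAbs : ℤ) < n := by exact_mod_cast hlt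
      gcongr
    exact_mod_cast this
  have h2 : ((n : ℚ) ^ 2 - (a : ℚ) ^ 2) / (b : ℚ) < 0 := div_neg_of_pos_of_neg (by linarith) hbQ
  rw [hk] at h2
  exact absurd h2 (not_lt.mpr (Nat.cast_nonneg k))

theorem padicNorm_rationalFishburnCoeff_le {p : ℕ} [Fact p.Prime] {M : ℕ} (hpM : ¬ p ∣ M)
    {a b : ℤ} {χ : ℤ → ℤ} {C : ℝ} (hC : 0 ≤ C) {m : ℕ}
    (h : ∀ n, ‖(binomialTerm a b m n : ℚ_[p])‖ ≤ C) :
    ‖(rationalFishburnCoeff M a b (fun n => (χ n : ℚ)) m : ℚ_[p])‖ ≤ C := by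
  unfold rationalFishburnCoeff
  push_cast
  rw [norm_mul, norm_pow, norm_neg, norm_one, one_pow, one_mul]
  refine padicNorm_sum_le _ _ hC fun k _ => ?_
  rw [norm_mul]
  have h1 := padicNorm_regularizedCoeff_le (p := p) hpM (χ := fun n => (χ n : ℚ))
    (fun n => by simpa using Padic.norm_int_le_one (p := p) (χ n)) k
  exact (mul_le_mul h1 (padicNorm_fwdDiff_iterate_le h k 0) (norm_nonneg _) zero_le_one).trans
    (one_mul C).le

theorem IsGoodFunction.isMeanZeroPeriodic {M : ℕ} {χ : ℤ → ℤ} (hχ : IsGoodFunction M χ) :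
    IsMeanZeroPeriodic M fun n => (χ n : ℚ) where
  periodic n := by
    have := hχ.periodic n
    push_cast
    rw [this]
  sum_eq_zero := by exact_mod_cast hχ.mean_zero

theorem IsFishburnExpansion.fishburnCoeff_eq {a b : ℤ} {χ : ℤ → ℤ} {H : ℕ → ℝ}
    (h : IsFishburnExpansion a b χ H) : fishburnCoeff a b χ = H := by
  have hex : ∃ H : ℕ → ℝ, IsFishburnExpansion a b χ H := ⟨H, h⟩
  rw [fishburnCoeff, dif_pos hex]
  exact hex.choose_spec.unique h

/-- The coefficients are `p`-adically as small as `n * binom ((n² - a²) / b, m)` is for all `n`. -/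
theorem exists_isFishburnExpansion {M : ℕ} (hM : 0 < M) {χ : ℤ → ℤ} (hχ : IsGoodFunction M χ)
    {a b : ℤ} (hb : b ≠ 0) (hP : PartialThetaIsPowerSeries a b χ) :
    ∃ H : ℕ → ℚ, IsFishburnExpansion a b χ (fun m => (H m : ℝ)) ∧
      ∀ (p : ℕ) [Fact p.Prime], ¬ p ∣ M → ∀ (C : ℝ), 0 ≤ C → ∀ m,
        (∀ n, ‖(binomialTerm a b m n : ℚ_[p])‖ ≤ C) → ‖(H m : ℚ_[p])‖ ≤ C := by
  rcases lt_or_gt_of_ne hb with hneg | hpos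
  · refine ⟨0, fun N => ?_, fun p _ _ C hC m _ => by simpa using hC⟩
    have h0 : ∀ t : ℝ, partialTheta a b χ (Real.exp (-t)) = 0 := fun t => by
      simp [partialTheta, eq_zero_of_partialThetaIsPowerSeries hM hneg hχ.periodic hP]
    simpa [h0] using isBigO_zero _ _
  · exact ⟨_, isFishburnExpansion_rationalFishburnCoeff hM hpos hχ.isMeanZeroPeriodic,
      fun p _ hpM C hC m h => padicNorm_rationalFishburnCoeff_le hpM hC h⟩

theorem theorem1p1 (M : ℕ) (hM : 0 < M) (χ : ℤ → ℤ) (hχ : IsGoodFunction M χ)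
    (a b : ℤ) (hb : b ≠ 0) (hP : PartialThetaIsPowerSeries a b χ) :
    IsFishburnExpansion a b χ (fishburnCoeff a b χ) ∧
    ∀ (p : ℕ) [Fact p.Prime], ¬ (p : ℤ) ∣ b → ¬ p ∣ M →
      (∀ B : ℕ, 0 < B →
        (∀ j : ℕ, 1 ≤ j → j ≤ B → legendreSym p (a ^ 2 - (j : ℤ) * b) = -1) →
        ∀ A n : ℕ, 0 < A → 0 < n →
          B < p ^ A * n ∧ IsZeroModPrimePow p A (fishburnCoeff a b χ (p ^ A * n - B))) ∧
      (secondDigit p a b ≠ p - 1 →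
        ∀ B : ℕ, 0 < B →
        (∀ j : ℕ, 1 ≤ j → j ≤ B → legendreSym p (a ^ 2 - (j : ℤ) * b) ≠ 1) →
        ∀ A n : ℕ, 0 < A → 0 < n →
          B < p ^ A * n ∧ IsZeroModPrimePow p A (fishburnCoeff a b χ (p ^ A * n - B))) := by
  obtain ⟨H, hH, hHp⟩ := exists_isFishburnExpansion hM hχ hb hP
  rw [hH.fishburnCoeff_eq]
  refine ⟨hH, fun p _ hpb hpM => ?_⟩
  have key : ∀ B : ℕ, 0 < B →
      (∀ j : ℕ, 1 ≤ j → j ≤ B → legendreSym p (a ^ 2 - (j : ℤ) * b) ≠ 1) →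
      (∀ j : ℕ, 1 ≤ j → j ≤ B → ¬ ((p : ℤ) ^ 2 ∣ a ^ 2 - (j : ℤ) * b)) →
      ∀ A n : ℕ, 0 < A → 0 < n →
        B < p ^ A * n ∧ IsZeroModPrimePow p A (H (p ^ A * n - B) : ℝ) := by
    intro B hB hleg hsq A n hA hn
    have hBp := lt_of_legendreSym_ne_one hpb hleg
    have hlt : B < p ^ A * n := hBp.trans_le ((Nat.le_self_pow hA.ne' p).trans
      (Nat.le_mul_of_pos_right _ hn))
    refine ⟨hlt, isZeroModPrimePow_of_padicNorm_le (hHp p hpM _ (by positivity) _ fun k => ?_)⟩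
    refine padicNorm_mul_choose_le hpb hB hBp hleg hsq k ?_
    rw [Nat.sub_add_cancel hlt.le]
    exact dvd_mul_right _ _
  -- In part 1 the symbol `-1` rules out even `p ∣ a² - j b`; in part 2, `p² ∣ a² - j b` would force
  -- `β_p = p - 1`.
  refine ⟨fun B hB hleg => key B hB (fun j h1 h2 => by rw [hleg j h1 h2]; decide)
    fun j h1 h2 hdvd => ?_, fun hβ B hB hleg => key B hB hleg fun j h1 h2 hdvd => ?_⟩
  · have h0 : legendreSym p (a ^ 2 - (j : ℤ) * b) = 0 := by
      rw [legendreSym.eq_zero_iff, ZMod.intCast_zmod_eq_zero_iff_dvd]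
      exact (dvd_pow_self _ two_ne_zero).trans hdvd
    rw [hleg j h1 h2] at h0
    exact absurd h0 (by decide)
  · exact hβ (secondDigit_eq_of_sq_dvd hpb h1
      (h2.trans_lt (lt_of_legendreSym_ne_one hpb hleg)) hdvd)
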